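/- Let $q\in\mathbb{C}$ with $0<|q|<1$, fix a logarithm $t$ of $q$ (so $e^t=q$), and set $q^r=e^{rt}$ for rational $r$. For $n\in\mathbb{Z}$ let $(a)_n=(a;q)_\infty/(aq^n;q)_\infty$, with the convention $1/(q)_n=0$ for $n<0$, and let $\left[{m+n\atop n}\right]=\frac{(q)_{m+n}}{(q)_m(q)_n}$ if $m,n\ge 0$ and $0$ otherwise. Let $N\ge 1$, $\ell$, $M$ be integers and $\sigma\in\{0,1\}$ such that $\ell+\sigma N$ is even. Let $C$ be the Cartan matrix of type $A_{N-1}$, $\mathcal{I}=2I-C$, let $e_1,\dots,e_{N-1}$ be the standard unit vectors of $\mathbb{Z}^{N-1}$, and for $m,n\in\mathbb{Z}^{N-1}$ put $\left[{m+n\atop n}\right]=\prod_{j=1}^{N-1}\left[{m_j+n_j\atop n_j}\right]$ and $nC^{-1}n=\sum_{i,j}n_iC^{-1}_{ij}n_j$. For $L\in\mathbb{Z}$ define the (finite) sums $$A_L=\sum_{\substack{n\in\mathbb{Z}^{N-1}\\ \frac{2L+\ell+\sigma N}{2N}+(C^{-1}n)_1\in\mathbb{Z}}} q^{nC^{-1}n}\left[{m+n\atop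 n}\right],\qquad B_L=\sum_{\substack{\eta\in\mathbb{Z}^{N-1}\\ \frac{2L+\ell+\sigma N}{2N}+(C^{-1}\eta)_1\in\mathbb{Z}}} q^{\eta C^{-1}\eta}\left[{\mu+\eta\atop \eta}\right],$$ where $m,\mu\in\mathbb{Z}^{N-1}$ are determined by $m+n=\frac12\bigl(\mathcal{I}m+(2L+\ell)e_1\bigr)$ and $\mu+\eta=\frac12\bigl(\mathcal{I}\mu+(M+L+\ell)e_1+(M-L)e_{N-1}\bigr)$. (For $N=1$ both sums equal $1$.) (i) For every $L\in\mathbb{Z}$, $$\sum_{i=L}^{M}\frac{q^{i(i+\ell)/N}}{(q)_{i-L}(q)_{i+L+\ell}(q)_{M-i}}\,A_i=\frac{q^{L(L+\ell)/N}}{(q)_{M-L}(q)_{M+L+\ell}}\,B_L .$$ (ii) Suppose $\ell\ge 0$ and let $a=q^\ell$. Then the sequences $$\gamma_L=\frac{a^{L/N}q^{L^2/N}}{(q)_{M-L}(aq)_{M+L}}\,B_L,\qquad \delta_L=\frac{a^{L/N}q^{L^2/N}}{(q)_{M-L}}\,A_L\qquad(L\ge 0)$$ form a conjugate Bailey pair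 relative to $a$, that is, $\gamma_L=\sum_{r=L}^\infty\frac{\delta_r}{(q)_{r-L}(aq)_{r+L}}$ for all $L\ge 0$. (iii) Consequently, for $\ell\ge 0$ and every Bailey pair $(\alpha,\beta)$ relative to $a=q^\ell$, that is, all sequences with $\beta_L=\sum_{i=0}^L\frac{\alpha_i}{(q)_{L-i}(aq)_{L+i}}$ for all $L\ge 0$, one has $\sum_{L=0}^\infty\alpha_L\gamma_L=\sum_{L=0}^\infty\beta_L\delta_L$, where both series converge (they have only finitely many nonzero terms). -/

import Mathlib

noncomputable section

namespace ConjBailey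

/-- The `q`-shifted factorial `(a)_n = (a;q)_n` for every integer `n`:
`(a)_n = (1 - a)(1 - a q) ⋯ (1 - a q^(n-1))` for `n ≥ 0`, and
`(a)_{-n} = 1 / ((1 - a q^(-1)) ⋯ (1 - a q^(-n)))`, which is `(a)_∞ / (a q^n)_∞` in both cases.
For `n < 0` the product in `(q)_n` contains the factor `1 - q q^(-1) = 0`, so that the usual
convention `1 / (q)_n = 0` for `n < 0` holds with `x / 0 = 0`. -/
def qPoch (q a : ℂ) : ℤ → ℂ
  | Int.ofNat n => ∏ k ∈ Finset.range n, (1 - a * q ^ k)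
  | Int.negSucc n => (∏ k ∈ Finset.range (n + 1), (1 - a * q ^ (-((k : ℤ) + 1))))⁻¹

/-- The `q`-binomial coefficient with top entry `m + n` and bottom entry `m` (equivalently `n`):
`(q)_{m+n} / ((q)_m (q)_n)` if `m, n ≥ 0` and `0` otherwise. -/
def qBinom (q : ℂ) (m n : ℤ) : ℂ :=
  if 0 ≤ m ∧ 0 ≤ n then qPoch q q (m + n) / (qPoch q q m * qPoch q q n) else 0

/-- The rational power `q ^ r = exp (r t)` of `q = exp t`. -/
def qPow (t : ℂ) (r : ℚ) : ℂ := Complex.exp ((r : ℂ) * t)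

/-- The vector with a `1` in its first component and `0` elsewhere (empty if `d = 0`). -/
def eFirst (d : ℕ) : Fin d → ℤ := fun j => if (j : ℕ) = 0 then 1 else 0

/-- The vector with a `1` in its last component and `0` elsewhere (empty if `d = 0`). -/
def eLast (d : ℕ) : Fin d → ℤ := fun j => if (j : ℕ) + 1 = d then 1 else 0

/-- `C⁻¹ n`, with `C` the Cartan matrix of type `A_d`. -/
def cartanInv (d : ℕ) (n : Fin d → ℤ) : Fin d → ℚ :=
  ((CartanMatrix.A d).map (Int.cast : ℤ → ℚ))⁻¹.mulVec (fun j => (n j : ℚ))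

/-- The first component `(C⁻¹ n)₁` (which is `0` if `d = 0`). -/
def cartanInvFirst (d : ℕ) (n : Fin d → ℤ) : ℚ := ∑ j, (eFirst d j : ℚ) * cartanInv d n j

/-- The quadratic form `n C⁻¹ n`. -/
def cartanInvForm (d : ℕ) (n : Fin d → ℤ) : ℚ := ∑ j, (n j : ℚ) * cartanInv d n j

/-- The system `m + n = (𝓘 m + b) / 2`, where `𝓘 = 2 I - C` is the incidence matrix of `A_d`. -/
def System (d : ℕ) (b m n : Fin d → ℤ) : Prop :=
  ∀ j, 2 * (m j + n j) = ((2 : Matrix (Fin d) (Fin d) ℤ) - CartanMatrix.A d).mulVec m j + b j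

/-- The summand `q^(n C⁻¹ n) ∏_j [m_j + n_j; n_j]`. -/
def fermionicTerm (q t : ℂ) (d : ℕ) (m n : Fin d → ℤ) : ℂ :=
  qPow t (cartanInvForm d n) * ∏ j, qBinom q (m j) (n j)

/-- The sum of `q^(n C⁻¹ n) ∏_j [m_j + n_j; n_j]` over all `n ∈ ℤ^d` with `c + (C⁻¹ n)₁ ∈ ℤ`, where
`m ∈ ℤ^d` is determined by `n` through the system `m + n = (𝓘 m + b) / 2`. As `C` is invertible,
each `n` admits at most one such `m`, and summing over `n` is summing over the integral solutions
`(m, n)` of the system. Only finitely many summands are nonzero (`finite_nonzero_terms`). -/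
def fermionicSum (q t : ℂ) (d : ℕ) (b : Fin d → ℤ) (c : ℚ) : ℂ :=
  ∑ᶠ p ∈ {p : (Fin d → ℤ) × (Fin d → ℤ) |
      System d b p.1 p.2 ∧ ∃ z : ℤ, c + cartanInvFirst d p.2 = z},
    fermionicTerm q t d p.1 p.2

/-- The `n`-sum: `m + n = (𝓘 m + (2 L + ℓ) e₁) / 2` and
`(2 L + ℓ + σ N) / (2 N) + (C⁻¹ n)₁ ∈ ℤ`. -/
def nSum (q t : ℂ) (N : ℕ) (σ ℓ L : ℤ) : ℂ :=
  fermionicSum q t (N - 1) ((2 * L + ℓ) • eFirst (N - 1))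
    (((2 * L + ℓ + σ * N : ℤ) : ℚ) / (2 * (N : ℚ)))

/-- The `η`-sum: `μ + η = (𝓘 μ + (M + L + ℓ) e₁ + (M - L) e_{N-1}) / 2` and
`(2 L + ℓ + σ N) / (2 N) + (C⁻¹ η)₁ ∈ ℤ`. -/
def etaSum (q t : ℂ) (N : ℕ) (σ ℓ M L : ℤ) : ℂ :=
  fermionicSum q t (N - 1) ((M + L + ℓ) • eFirst (N - 1) + (M - L) • eLast (N - 1))
    (((2 * L + ℓ + σ * N : ℤ) : ℚ) / (2 * (N : ℚ)))

/-- `a^(L/N) q^(L²/N) = q^(L (L + ℓ) / N)` for `a = q^ℓ`. -/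
def prefactor (t : ℂ) (N : ℕ) (ℓ L : ℤ) : ℂ :=
  qPow t ((ℓ : ℚ) * ((L : ℚ) / N)) * qPow t ((L : ℚ) ^ 2 / N)

/-- The sequence `γ`, with `a = q^ℓ`. -/
def gammaSeq (q t : ℂ) (N : ℕ) (σ ℓ M : ℤ) (L : ℕ) : ℂ :=
  prefactor t N ℓ L / (qPoch q q (M - L) * qPoch q (q ^ ℓ * q) (M + L)) * etaSum q t N σ ℓ M L

/-- The sequence `δ`, with `a = q^ℓ`. -/
def deltaSeq (q t : ℂ) (N : ℕ) (σ ℓ M : ℤ) (L : ℕ) : ℂ :=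
  prefactor t N ℓ L / qPoch q q (M - L) * nSum q t N σ ℓ L

/-- `(α, β)` is a Bailey pair relative to `a`. -/
def IsBaileyPair (q a : ℂ) (α β : ℕ → ℂ) : Prop :=
  ∀ L : ℕ, β L = ∑ i ∈ Finset.range (L + 1),
    α i / (qPoch q q ((L : ℤ) - i) * qPoch q (a * q) ((L : ℤ) + i))

/-- `(γ, δ)` is a conjugate Bailey pair relative to `a`. -/
def IsConjugateBaileyPair (q a : ℂ) (γ δ : ℕ → ℂ) : Prop :=
  ∀ L : ℕ, HasSum (fun r : {r : ℕ // L ≤ r} =>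
    δ r / (qPoch q q (((r : ℕ) : ℤ) - L) * qPoch q (a * q) (((r : ℕ) : ℤ) + L))) (γ L)

theorem weighted_column_sum (d : ℕ) (j : Fin d) :
    ∑ i : Fin d, ((i : ℤ) + 1) * ((d : ℤ) - i) * CartanMatrix.A d i j = 2 := by
  have hA : ∀ i : Fin d, ((i : ℤ) + 1) * ((d : ℤ) - i) * CartanMatrix.A d i j =
      (if (i : ℕ) = j then 2 * (((i : ℤ) + 1) * ((d : ℤ) - i)) else 0)
      - (if (i : ℕ) + 1 = j then ((i : ℤ) + 1) * ((d : ℤ) - i) else 0)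
      - (if (i : ℕ) = (j : ℕ) + 1 then ((i : ℤ) + 1) * ((d : ℤ) - i) else 0) := by
    intro i
    simp only [CartanMatrix.A, Matrix.of_apply, Fin.ext_iff]
    split_ifs <;> omega
  have hj := j.isLt
  rw [Finset.sum_congr rfl fun i _ => hA i,
    Fin.sum_univ_eq_sum_range (fun i : ℕ =>
      (if i = (j : ℕ) then 2 * (((i : ℤ) + 1) * ((d : ℤ) - i)) else 0)
      - (if i + 1 = (j : ℕ) then ((i : ℤ) + 1) * ((d : ℤ) - i) else 0)
      - (if i = (j : ℕ) + 1 then ((i : ℤ) + 1) * ((d : ℤ) - i) else 0)),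
    Finset.sum_sub_distrib, Finset.sum_sub_distrib]
  have h1 : ∑ i ∈ Finset.range d,
      (if i = (j : ℕ) then 2 * (((i : ℤ) + 1) * ((d : ℤ) - i)) else 0)
      = 2 * (((j : ℤ) + 1) * ((d : ℤ) - j)) := by
    rw [Finset.sum_ite_eq' (Finset.range d) (j : ℕ)
      (fun i : ℕ => 2 * (((i : ℤ) + 1) * ((d : ℤ) - i)))]
    simp [hj]
  have h2 : ∑ i ∈ Finset.range d,
      (if i + 1 = (j : ℕ) then ((i : ℤ) + 1) * ((d : ℤ) - i) else 0)
      = (j : ℤ) * ((d : ℤ) - j + 1) := by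
    rcases Nat.eq_zero_or_pos (j : ℕ) with h0 | h0
    · simp [h0]
    · obtain ⟨k, hk⟩ : ∃ k, (j : ℕ) = k + 1 := ⟨j - 1, by omega⟩
      have : k < d := by omega
      simp only [hk, Nat.add_right_cancel_iff]
      rw [Finset.sum_ite_eq' (Finset.range d) k (fun i : ℕ => ((i : ℤ) + 1) * ((d : ℤ) - i))]
      simp only [Finset.mem_range, this, if_true]
      push_cast
      ring
  have h3 : ∑ i ∈ Finset.range d,
      (if i = (j : ℕ) + 1 then ((i : ℤ) + 1) * ((d : ℤ) - i) else 0)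
      = ((j : ℤ) + 2) * ((d : ℤ) - j - 1) := by
    rw [Finset.sum_ite_eq' (Finset.range d) ((j : ℕ) + 1)
      (fun i : ℕ => ((i : ℤ) + 1) * ((d : ℤ) - i))]
    by_cases h : (j : ℕ) + 1 < d
    · simp [h]; ring
    · have : (d : ℤ) - j - 1 = 0 := by omega
      simp [h, this]
  rw [h1, h2, h3]; ring

/-- Only finitely many solutions of the system have a nonzero summand, so that the sum in
`fermionicSum` is a genuine finite sum. -/
theorem finite_nonzero_terms (q t : ℂ) (d : ℕ) (b : Fin d → ℤ) :
    {p : (Fin d → ℤ) × (Fin d → ℤ) |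
      System d b p.1 p.2 ∧ fermionicTerm q t d p.1 p.2 ≠ 0}.Finite := by
  set w : Fin d → ℤ := fun i => ((i : ℤ) + 1) * ((d : ℤ) - i) with hw
  set B : ℤ := ∑ i, w i * b i with hB
  refine ((Set.finite_Icc (fun _ => 0 : Fin d → ℤ) (fun _ => B)).prod
    (Set.finite_Icc (fun _ => 0 : Fin d → ℤ) (fun _ => B))).subset ?_
  rintro ⟨m, n⟩ ⟨hs, h0⟩
  have hpos : ∀ j, 0 ≤ m j ∧ 0 ≤ n j := by
    intro j
    by_contra hc
    apply h0
    have : ∏ j, qBinom q (m j) (n j) = 0 :=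
      Finset.prod_eq_zero (Finset.mem_univ j) (by simp [qBinom, hc])
    simp [fermionicTerm, this]
  have hsys : ∀ j, (∑ k, CartanMatrix.A d j k * m k) + 2 * n j = b j := by
    intro j
    have h := hs j
    rw [Matrix.sub_mulVec, Pi.sub_apply, Matrix.ofNat_mulVec] at h
    simp only [Matrix.mulVec, dotProduct, Pi.smul_apply] at h
    simp at h
    linarith
  have key : 2 * ∑ k, m k + 2 * ∑ j, w j * n j = B := by
    have e1 : ∑ j, w j * ∑ k, CartanMatrix.A d j k * m k = 2 * ∑ k, m k := by
      simp only [Finset.mul_sum]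
      rw [Finset.sum_comm]
      refine Finset.sum_congr rfl fun k _ => ?_
      have := weighted_column_sum d k
      rw [← this, Finset.sum_mul]
      exact Finset.sum_congr rfl fun i _ => by simp only [hw]; ring
    rw [hB, ← e1, Finset.mul_sum, ← Finset.sum_add_distrib]
    refine Finset.sum_congr rfl fun j _ => ?_
    rw [← hsys j]; ring
  have hw1 : ∀ j, 1 ≤ w j := by
    intro j
    have := j.isLt
    have h1 : (1 : ℤ) ≤ (j : ℤ) + 1 := by omega
    have h2 : (1 : ℤ) ≤ (d : ℤ) - j := by omega
    simp only [hw]; nlinarith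
  have hwn : ∀ j, 0 ≤ w j * n j := fun j => mul_nonneg (by linarith [hw1 j]) (hpos j).2
  have hm : ∀ j, m j ≤ ∑ k, m k := fun j =>
    Finset.single_le_sum (f := m) (fun k _ => (hpos k).1) (Finset.mem_univ j)
  have hn : ∀ j, w j * n j ≤ ∑ k, w k * n k := fun j =>
    Finset.single_le_sum (f := fun k => w k * n k) (fun k _ => hwn k) (Finset.mem_univ j)
  have hM0 : 0 ≤ ∑ k, m k := Finset.sum_nonneg fun k _ => (hpos k).1
  have hN0 : 0 ≤ ∑ k, w k * n k := Finset.sum_nonneg fun k _ => hwn k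
  refine ⟨⟨fun j => (hpos j).1, fun j => ?_⟩, ⟨fun j => (hpos j).2, fun j => ?_⟩⟩
  · have := hm j
    show m j ≤ B
    linarith
  · have h1 := hn j
    have h2 : n j ≤ w j * n j := by nlinarith [hw1 j, (hpos j).2]
    show n j ≤ B
    linarith

end ConjBailey

end

/-! Both fermionic sums are partition functions of one path model. A solution `(m, n)` of the system
is read as a path with `N` steps from `a` to `b` through the entries of `m`; then `n` is half the
second difference of the path and `C⁻¹ n` is half the gap between its chord and the path. Hence `n
C⁻¹ n` is the sum of the squared steps over 4, minus `(a - b) ^ 2 / (4 N)`, the integrality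
condition fixes the parity of every step, and the summand factors into local weights
(`fermionicSum_eq`). The `η`-sum has ends `a = M + L + ℓ`, `b = M - L`; the `n`-sum with index `i`
has ends `2 i + ℓ` and `0`.

Let `P(a, b)` be the path sum. The `q`-Pascal rule and the ratio of neighbouring step weights let a
local defect travel from one end of the path to the other, which gives `P(a+1, b) + (1 - q^a) P(a-1,
b) = P(a, b+1) + (1 - q^b) P(a, b-1)` (`pathSum_recurrence`). The operator at each end is that of
the continuous `q`-Hermite polynomials, so `P(a, b)` is determined by `P(·, 0)` exactly as `H_a H_b`
is expanded in the `H_{a+b-2k}` (`pathSum_eq_linearization`). With `k = M - i` this expansion is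
(i). Part (ii) is (i) multiplied by `(q)_ℓ`, and (iii) is an interchange of finite sums. -/

namespace ConjBailey

open Finset

/-! ### `q`-factorials and Gaussian binomials. -/

theorem qPoch_of_neg (q : ℂ) (hq0 : q ≠ 0) {n : ℤ} (hn : n < 0) : qPoch q q n = 0 := by
  obtain ⟨k, rfl⟩ := Int.eq_negSucc_of_lt_zero hn
  simp only [qPoch, inv_eq_zero]
  exact Finset.prod_eq_zero (Finset.mem_range.2 (Nat.succ_pos k)) (by simp [hq0])

theorem qPoch_zero (q a : ℂ) : qPoch q a 0 = 1 := by
  change qPoch q a (Int.ofNat 0) = 1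
  simp [qPoch]

theorem qPoch_succ (q a : ℂ) {n : ℤ} (hn : 0 ≤ n) :
    qPoch q a (n + 1) = qPoch q a n * (1 - a * q ^ n) := by
  obtain ⟨k, rfl⟩ := Int.eq_ofNat_of_zero_le hn
  change qPoch q a (Int.ofNat (k + 1)) = qPoch q a (Int.ofNat k) * _
  simp [qPoch, Finset.prod_range_succ]

theorem one_sub_zpow_ne_zero {q : ℂ} (hq : ‖q‖ < 1) {n : ℤ} (hn : 0 < n) : 1 - q ^ n ≠ 0 := by
  obtain ⟨k, rfl⟩ := Int.eq_ofNat_of_zero_le hn.le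
  intro h
  have h1 : q ^ k = 1 := by
    have := sub_eq_zero.1 h
    simpa using this.symm
  have h2 : ‖q‖ ^ k = 1 := by rw [← norm_pow, h1, norm_one]
  exact (pow_lt_one₀ (norm_nonneg q) hq (by omega)).ne h2

theorem qPoch_ne_zero {q : ℂ} (hq0 : q ≠ 0) (hq : ‖q‖ < 1) {n : ℤ} (hn : 0 ≤ n) :
    qPoch q q n ≠ 0 := by
  induction n, hn using Int.leInduction with
  | base => simp [qPoch_zero]
  | succ n hn ih =>
    rw [qPoch_succ q q hn, ← zpow_one_add₀ hq0]
    exact mul_ne_zero ih (one_sub_zpow_ne_zero hq (by omega))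

/-- The reciprocal `1 / (q)_n`, which vanishes for `n < 0`. -/
noncomputable def qPochInv (q : ℂ) (n : ℤ) : ℂ := (qPoch q q n)⁻¹

theorem qPochInv_of_neg {q : ℂ} (hq0 : q ≠ 0) {n : ℤ} (hn : n < 0) : qPochInv q n = 0 := by
  simp [qPochInv, qPoch_of_neg q hq0 hn]

theorem qPochInv_zero (q : ℂ) : qPochInv q 0 = 1 := by
  simp [qPochInv, qPoch_zero]

/-- Valid for every integer `n`, including `n ≤ 0`, where both sides vanish; so later recurrences
need no separate treatment of boundary terms. -/
theorem qPochInv_sub_one {q : ℂ} (hq0 : q ≠ 0) (hq : ‖q‖ < 1) (n : ℤ) :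
    qPochInv q (n - 1) = (1 - q ^ n) * qPochInv q n := by
  rcases lt_trichotomy n 0 with h | rfl | h
  · rw [qPochInv_of_neg hq0 h, qPochInv_of_neg hq0 (by omega), mul_zero]
  · rw [qPochInv_of_neg hq0 (by omega)]
    simp
  · have h1 := qPoch_succ q q (n := n - 1) (by omega)
    rw [sub_add_cancel, ← zpow_one_add₀ hq0, add_sub_cancel] at h1
    have h2 := one_sub_zpow_ne_zero hq h
    have h3 := qPoch_ne_zero hq0 hq (n := n - 1) (by omega)
    rw [qPochInv, qPochInv, h1]
    field_simp

/-- The `q`-binomial coefficient `[s; x]` in terms of its top and bottom entries. -/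
noncomputable def gaussBinom (q : ℂ) (s x : ℤ) : ℂ := qBinom q x (s - x)

theorem gaussBinom_eq {q : ℂ} (hq0 : q ≠ 0) (s x : ℤ) :
    gaussBinom q s x = qPoch q q s * (qPochInv q x * qPochInv q (s - x)) := by
  unfold gaussBinom qBinom
  split_ifs with h
  · rw [add_sub_cancel, qPochInv, qPochInv, div_eq_mul_inv, mul_inv]
  · rcases not_and_or.1 h with h | h
    · simp [qPochInv_of_neg hq0 (not_le.1 h)]
    · simp [qPochInv_of_neg hq0 (not_le.1 h)]

theorem gaussBinom_of_neg (q : ℂ) (s : ℤ) {x : ℤ} (hx : x < 0) : gaussBinom q s x = 0 := by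
  simp [gaussBinom, qBinom, not_le.2 hx]

theorem gaussBinom_of_lt (q : ℂ) {s x : ℤ} (hx : s < x) : gaussBinom q s x = 0 := by
  have : ¬ (0 ≤ x ∧ 0 ≤ s - x) := by omega
  rw [gaussBinom, qBinom, if_neg this]

theorem gaussBinom_succ {q : ℂ} (hq0 : q ≠ 0) (hq : ‖q‖ < 1) {s : ℤ} (hs : 0 ≤ s) (x : ℤ) :
    gaussBinom q (s + 1) x = gaussBinom q s (x - 1) + q ^ x * gaussBinom q s x := by
  rw [gaussBinom_eq hq0, gaussBinom_eq hq0, gaussBinom_eq hq0, qPoch_succ q q hs,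
    ← zpow_one_add₀ hq0, qPochInv_sub_one hq0 hq x,
    show s - x = (s + 1 - x) - 1 by ring, qPochInv_sub_one hq0 hq (s + 1 - x),
    show s - (x - 1) = s + 1 - x by ring,
    show (1 + s : ℤ) = x + (s + 1 - x) by ring, zpow_add₀ hq0]
  ring

theorem qPow_add (t : ℂ) (r s : ℚ) : qPow t (r + s) = qPow t r * qPow t s := by
  simp [qPow, ← Complex.exp_add, add_mul]

theorem qPow_zero (t : ℂ) : qPow t 0 = 1 := by simp [qPow]

theorem qPow_intCast {q t : ℂ} (ht : Complex.exp t = q) (n : ℤ) : qPow t n = q ^ n := by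
  rw [← ht, ← Complex.exp_int_mul]
  simp [qPow]

/-! ### Local weights of paths and the defect identities. -/

/-- The weight `q ^ (k ^ 2 / 4)` of a step `k ≡ σ` modulo `2`. -/
noncomputable def stepWeight (t : ℂ) (σ k : ℤ) : ℂ :=
  if Even (k + σ) then qPow t ((k : ℚ) ^ 2 / 4) else 0

/-- This is `(k + 1)² - (k - 1)² = 4 k`. -/
theorem stepWeight_add_one {q t : ℂ} (ht : Complex.exp t = q) (σ k : ℤ) :
    stepWeight t σ (k + 1) = q ^ k * stepWeight t σ (k - 1) := by
  unfold stepWeight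
  have h : Even (k + 1 + σ) ↔ Even (k - 1 + σ) := by
    rw [Int.even_iff, Int.even_iff]; omega
  simp only [h]
  split_ifs
  · rw [← qPow_intCast ht, ← qPow_add]
    congr 1
    push_cast
    ring
  · simp

/-- The weight `[S / 2; x]` of a vertex `x` whose neighbours have sum `S`. -/
noncomputable def vertexWeight (q : ℂ) (S x : ℤ) : ℂ :=
  if Even S then gaussBinom q (S / 2) x else 0

theorem vertexWeight_of_neg (q : ℂ) (S : ℤ) {x : ℤ} (hx : x < 0) : vertexWeight q S x = 0 := by
  simp [vertexWeight, gaussBinom_of_neg q _ hx]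

theorem vertexWeight_of_lt (q : ℂ) {S x : ℤ} (hx : S < 2 * x) : vertexWeight q S x = 0 := by
  unfold vertexWeight
  split_ifs
  · exact gaussBinom_of_lt q (by omega)
  · rfl

/-- The `q`-Pascal rule. The value `S = -1` is allowed because both sides vanish for odd `S`; it
occurs when both neighbours of a defect are `0`. -/
theorem vertexWeight_succ {q : ℂ} (hq0 : q ≠ 0) (hq : ‖q‖ < 1) {S : ℤ} (hS : 0 ≤ S + 1) (x : ℤ) :
    vertexWeight q (S + 2) x = vertexWeight q S (x - 1) + q ^ x * vertexWeight q S x := by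
  unfold vertexWeight
  have h : Even (S + 2) ↔ Even S := by
    rw [Int.even_iff, Int.even_iff]; omega
  simp only [h]
  split_ifs with h2
  · rw [show (S + 2) / 2 = S / 2 + 1 by omega]
    rw [Int.even_iff] at h2
    exact gaussBinom_succ hq0 hq (by omega) x
  · simp

/-- Creates or absorbs a defect: the three-term operator at the end `b` becomes a modification of
the neighbouring vertex `y`. After the `q`-Pascal rule, `q^y` times the weight of the step `y - b -
1` is `q^b` times that of `y - b + 1`, which cancels the `q^b` in the coefficient. -/
theorem defect_at_end {q t : ℂ} (ht : Complex.exp t = q) (hq0 : q ≠ 0) (hq : ‖q‖ < 1) (σ : ℤ)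
    {S : ℤ} (hS : 0 ≤ S + 1) (b y : ℤ) :
    vertexWeight q (S + 2) y * stepWeight t σ (y - b - 1) +
        (1 - q ^ b) * (vertexWeight q S y * stepWeight t σ (y - b + 1)) =
      vertexWeight q S (y - 1) * stepWeight t σ (y - b - 1) +
        vertexWeight q S y * stepWeight t σ (y - b + 1) := by
  have h1 := vertexWeight_succ hq0 hq hS y
  have h2 := stepWeight_add_one ht σ (y - b)
  have h3 : q ^ y = q ^ b * q ^ (y - b) := by rw [← zpow_add₀ hq0]; congr 1; ring
  rw [h1, h2, h3]
  ring

/-- Passes a defect from the vertex `y` to its neighbour `e`: the `q`-Pascal corrections at the two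
vertices agree, since `q^y` and `q^e` differ by the ratio of the two step weights. -/
theorem defect_in_middle {q t : ℂ} (ht : Complex.exp t = q) (hq0 : q ≠ 0) (hq : ‖q‖ < 1) (σ : ℤ)
    {S T : ℤ} (hS : 0 ≤ S + 1) (hT : 0 ≤ T + 1) (y e : ℤ) :
    vertexWeight q S (y - 1) * stepWeight t σ (y - e - 1) * vertexWeight q T e +
        vertexWeight q S y * stepWeight t σ (y - e + 1) * vertexWeight q (T + 2) e =
      vertexWeight q S y * stepWeight t σ (y - e + 1) * vertexWeight q T (e - 1) +
        vertexWeight q (S + 2) y * stepWeight t σ (y - e - 1) * vertexWeight q T e := by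
  have h2 := stepWeight_add_one ht σ (y - e)
  have h3 : q ^ y = q ^ e * q ^ (y - e) := by rw [← zpow_add₀ hq0]; congr 1; ring
  rw [vertexWeight_succ hq0 hq hS y, vertexWeight_succ hq0 hq hT e, h2, h3]
  ring

/-! ### Path sums and the transport of a defect. -/

/-- The sum over all paths `a, c, …, b` with `d + 1` steps whose interior vertices lie in `[0, K]`,
with the weights of the interior vertices and of all steps but the first. -/
noncomputable def tailSum (q t : ℂ) (σ K b : ℤ) : ℕ → ℤ → ℤ → ℂ
  | 0, _, c => if c = b then 1 else 0
  | d + 1, a, c => ∑ e ∈ Icc 0 K,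
      vertexWeight q (a + e) c * stepWeight t σ (c - e) * tailSum q t σ K b d c e

theorem tailSum_succ (q t : ℂ) (σ K b : ℤ) (d : ℕ) (a c : ℤ) :
    tailSum q t σ K b (d + 1) a c = ∑ e ∈ Icc 0 K,
      vertexWeight q (a + e) c * stepWeight t σ (c - e) * tailSum q t σ K b d c e := rfl

/-- The sum over all paths from `a` to `b` with `d + 1` steps whose interior vertices lie in
`[0, K]`. -/
noncomputable def pathSum (q t : ℂ) (σ K b : ℤ) (d : ℕ) (a : ℤ) : ℂ :=
  ∑ c ∈ Icc 0 K, stepWeight t σ (a - c) * tailSum q t σ K b d a c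

/-- Moving a defect displaces the summed vertex by one; the four vanishing conditions keep the
truncation to `[0, K]` from leaving boundary terms. -/
theorem sum_Icc_shift (K : ℤ) (f g : ℤ → ℂ) (hf0 : f (-1) = 0) (hfK : f K = 0)
    (hg0 : g (-1) = 0) (hgK : g K = 0) :
    ∑ e ∈ Icc 0 K, (f (e - 1) + g e) = ∑ z ∈ Icc 0 K, (f z + g (z - 1)) := by
  have key : ∀ h : ℤ → ℂ, h (-1) = 0 → h K = 0 →
      ∑ e ∈ Icc 0 K, h (e - 1) = ∑ e ∈ Icc 0 K, h e := by
    intro h h0 hK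
    rcases lt_or_ge K 0 with hneg | hpos
    · simp [Finset.Icc_eq_empty_of_lt hneg]
    have e1 : ∑ e ∈ Icc 0 K, h (e - 1) = ∑ e ∈ Icc (-1) (K - 1), h e :=
      Finset.sum_bij' (fun e _ => e - 1) (fun e _ => e + 1)
        (by intro e he; rw [mem_Icc] at *; omega) (by intro e he; rw [mem_Icc] at *; omega)
        (by intros; ring) (by intros; ring) (by intros; rfl)
    rw [e1]
    have s1 : ∑ e ∈ Icc (-1) (K - 1), h e = ∑ e ∈ Icc (-1) K, h e := by
      refine Finset.sum_subset (Icc_subset_Icc le_rfl (by omega)) fun e he he' => ?_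
      rw [mem_Icc] at he he'
      rw [show e = K by omega, hK]
    have s2 : ∑ e ∈ Icc 0 K, h e = ∑ e ∈ Icc (-1) K, h e := by
      refine Finset.sum_subset (Icc_subset_Icc (by omega) le_rfl) fun e he he' => ?_
      rw [mem_Icc] at he he'
      rw [show e = -1 by omega, h0]
    rw [s1, s2]
  rw [sum_add_distrib, sum_add_distrib, key f hf0 hfK, key g hg0 hgK]

/-- The sum of the weights of the paths `a, y, …, b` with a defect at the vertex `y`. -/
noncomputable def defectSum (q t : ℂ) (σ K b : ℤ) (d : ℕ) (a y : ℤ) : ℂ :=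
  ∑ e ∈ Icc 0 K,
    (vertexWeight q (a + e - 1) (y - 1) * stepWeight t σ (y - e - 1) *
        tailSum q t σ K b d (y - 1) e +
      vertexWeight q (a + e - 1) y * stepWeight t σ (y - e + 1) * tailSum q t σ K b d (y + 1) e)

/-- Induction on the length: `defect_in_middle` moves the defect one vertex to the right, and
`defect_at_end` absorbs it into the end `b`. -/
theorem defectSum_eq {q t : ℂ} (ht : Complex.exp t = q) (hq0 : q ≠ 0) (hq : ‖q‖ < 1) (σ K b : ℤ)
    (hb : 0 ≤ b) (hbK : b + 1 ≤ K) (d : ℕ) {a y : ℤ} (ha : 0 ≤ a) (hy : 0 ≤ y) (hyK : y ≤ K) :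
    defectSum q t σ K b d a y = tailSum q t σ K (b + 1) (d + 1) a y +
      (1 - q ^ b) * tailSum q t σ K (b - 1) (d + 1) a y := by
  induction d generalizing a y with
  | zero =>
    have hend := defect_at_end ht hq0 hq σ (S := a + b - 1) (by omega) b y
    simp only [defectSum, tailSum, mul_ite, mul_one, mul_zero, ← ite_add_zero, sum_ite_eq', mem_Icc]
    rw [if_pos (by omega), if_pos (by omega)]
    rw [show a + b - 1 + 2 = a + (b + 1) by ring] at hend
    -- For `b = 0` the end `b - 1` leaves `[0, K]`, but its coefficient `1 - q^b` is zero.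
    rcases hb.eq_or_lt with rfl | hb'
    · rw [if_neg (by omega), ← hend]
      simp
    · rw [if_pos (by omega), ← hend]
      rw [show y - b - 1 = y - (b + 1) by ring, show y - b + 1 = y - (b - 1) by ring,
        show a + b - 1 = a + (b - 1) by ring]
  | succ d ih =>
    have e1 : defectSum q t σ K b (d + 1) a y = ∑ e ∈ Icc 0 K,
        (vertexWeight q (a + (e - 1)) y * stepWeight t σ (y - (e - 1)) *
          (∑ f ∈ Icc 0 K, vertexWeight q (y + f - 1) (e - 1) * stepWeight t σ (e - 1 - f + 1) *
            tailSum q t σ K b d (e - 1 + 1) f) +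
        vertexWeight q (a + (e + 1)) y * stepWeight t σ (y - (e + 1)) *
          (∑ f ∈ Icc 0 K, vertexWeight q (y + f - 1) (e + 1 - 1) * stepWeight t σ (e + 1 - f - 1) *
            tailSum q t σ K b d (e + 1 - 1) f)) := by
      refine sum_congr rfl fun e he => ?_
      rw [mem_Icc] at he
      simp only [tailSum, mul_sum, ← sum_add_distrib]
      refine sum_congr rfl fun f hf => ?_
      rw [mem_Icc] at hf
      have hm := defect_in_middle ht hq0 hq σ (S := a + e - 1) (T := y + f - 1) (by omega)
        (by omega) y e
      have hm' := congrArg (fun z => z * (stepWeight t σ (e - f) * tailSum q t σ K b d e f)) hm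
      rw [show e - 1 - f + 1 = e - f by ring, show e + 1 - f - 1 = e - f by ring,
        show e - 1 + 1 = e by ring, show e + 1 - 1 = e by ring,
        show a + (e - 1) = a + e - 1 by ring, show a + (e + 1) = a + e - 1 + 2 by ring,
        show y - (e - 1) = y - e + 1 by ring, show y - (e + 1) = y - e - 1 by ring,
        show y - 1 + f = y + f - 1 by ring, show y + 1 + f = y + f - 1 + 2 by ring]
      linear_combination hm'
    rw [e1, sum_Icc_shift K
      (fun z => vertexWeight q (a + z) y * stepWeight t σ (y - z) *
          (∑ f ∈ Icc 0 K, vertexWeight q (y + f - 1) z * stepWeight t σ (z - f + 1) *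
            tailSum q t σ K b d (z + 1) f))
      (fun e => vertexWeight q (a + (e + 1)) y * stepWeight t σ (y - (e + 1)) *
          (∑ f ∈ Icc 0 K, vertexWeight q (y + f - 1) (e + 1 - 1) * stepWeight t σ (e + 1 - f - 1) *
            tailSum q t σ K b d (e + 1 - 1) f))]
    · simp only [tailSum_succ _ _ _ _ _ (d + 1), mul_sum (Icc 0 K) _ (1 - q ^ b),
        ← sum_add_distrib]
      refine sum_congr rfl fun z hz => ?_
      rw [mem_Icc] at hz
      have h := ih hy hz.1 hz.2
      rw [defectSum, sum_add_distrib] at h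
      rw [show z - 1 + 1 = z by ring]
      linear_combination (vertexWeight q (a + z) y * stepWeight t σ (y - z)) * h
    -- The boundary terms vanish: the bottom entry is `-1`, or it is `K` while the neighbour sum is
    -- at most `2 K - 1`.
    all_goals
      refine mul_eq_zero_of_right _ (sum_eq_zero fun f hf => ?_)
      rw [mem_Icc] at hf
    · rw [vertexWeight_of_neg q _ (by omega)]; simp
    · rw [vertexWeight_of_lt q (by omega)]; simp
    · rw [vertexWeight_of_neg q _ (by omega)]; simp
    · rw [vertexWeight_of_lt q (by omega)]; simp

theorem pathSum_zero (q t : ℂ) (σ K b a : ℤ) (hb : 0 ≤ b) (hbK : b ≤ K) :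
    pathSum q t σ K b 0 a = stepWeight t σ (a - b) := by
  simp [pathSum, tailSum, hb, hbK]

/-- The path sums intertwine the three-term operators of the continuous `q`-Hermite polynomials
at the two ends of the path. -/
theorem pathSum_recurrence {q t : ℂ} (ht : Complex.exp t = q) (hq0 : q ≠ 0) (hq : ‖q‖ < 1)
    (σ K : ℤ) (d : ℕ) {a b : ℤ} (ha : 0 ≤ a) (haK : a ≤ K) (hb : 0 ≤ b) (hbK : b + 1 ≤ K) :
    pathSum q t σ K b d (a + 1) + (1 - q ^ a) * pathSum q t σ K b d (a - 1) =
      pathSum q t σ K (b + 1) d a + (1 - q ^ b) * pathSum q t σ K (b - 1) d a := by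
  cases d with
  | zero =>
    have h2 := stepWeight_add_one ht σ (a - b)
    have h3 : q ^ a = q ^ b * q ^ (a - b) := by rw [← zpow_add₀ hq0]; congr 1; ring
    rw [pathSum_zero q t σ K b _ hb (by omega), pathSum_zero q t σ K b _ hb (by omega),
      pathSum_zero q t σ K (b + 1) _ (by omega) (by omega),
      show a + 1 - b = a - b + 1 by ring, show a - 1 - b = a - b - 1 by ring,
      show a - (b + 1) = a - b - 1 by ring]
    rcases hb.eq_or_lt with rfl | hb'
    · rw [h2, h3]; simp; ring
    · rw [pathSum_zero q t σ K (b - 1) _ (by omega) (by omega),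
        show a - (b - 1) = a - b + 1 by ring, h2, h3]
      ring
  | succ d =>
    have e1 : pathSum q t σ K b (d + 1) (a + 1) + (1 - q ^ a) * pathSum q t σ K b (d + 1) (a - 1)
        = ∑ c ∈ Icc 0 K,
          (stepWeight t σ (a - (c - 1)) *
            (∑ e ∈ Icc 0 K, vertexWeight q (a + e - 1) (c - 1) * stepWeight t σ (c - 1 - e + 1) *
              tailSum q t σ K b d (c - 1 + 1) e) +
          stepWeight t σ (a - (c + 1)) *
            (∑ e ∈ Icc 0 K, vertexWeight q (a + e - 1) (c + 1 - 1) *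
              stepWeight t σ (c + 1 - e - 1) * tailSum q t σ K b d (c + 1 - 1) e)) := by
      simp only [pathSum, mul_sum, ← sum_add_distrib, tailSum]
      refine sum_congr rfl fun c _ => sum_congr rfl fun e he => ?_
      rw [mem_Icc] at he
      have hend := defect_at_end ht hq0 hq σ (S := a + e - 1) (by omega) a c
      -- Step weights are even functions, so `defect_at_end` also serves at the left end.
      have hneg : ∀ k, stepWeight t σ (-k) = stepWeight t σ k := by
        intro k
        unfold stepWeight
        have : Even (-k + σ) ↔ Even (k + σ) := by rw [Int.even_iff, Int.even_iff]; omega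
        simp only [this]
        push_cast
        rw [neg_sq]
      rw [← hneg (c - a - 1), ← hneg (c - a + 1)] at hend
      have hend' := congrArg (fun z => z * (stepWeight t σ (c - e) * tailSum q t σ K b d c e)) hend
      rw [show c - 1 - e + 1 = c - e by ring, show c + 1 - e - 1 = c - e by ring,
        show c - 1 + 1 = c by ring, show c + 1 - 1 = c by ring,
        show a + 1 - c = -(c - a - 1) by ring, show a - 1 - c = -(c - a + 1) by ring,
        show a - (c - 1) = -(c - a - 1) by ring, show a - (c + 1) = -(c - a + 1) by ring,
        show a + 1 + e = a + e - 1 + 2 by ring, show a - 1 + e = a + e - 1 by ring]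
      linear_combination hend'
    rw [e1, sum_Icc_shift K
      (fun z => stepWeight t σ (a - z) *
            (∑ e ∈ Icc 0 K, vertexWeight q (a + e - 1) z * stepWeight t σ (z - e + 1) *
              tailSum q t σ K b d (z + 1) e))
      (fun c => stepWeight t σ (a - (c + 1)) *
            (∑ e ∈ Icc 0 K, vertexWeight q (a + e - 1) (c + 1 - 1) *
              stepWeight t σ (c + 1 - e - 1) * tailSum q t σ K b d (c + 1 - 1) e))]
    · simp only [pathSum, mul_sum (Icc 0 K) _ (1 - q ^ b), ← sum_add_distrib]
      refine sum_congr rfl fun z hz => ?_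
      rw [mem_Icc] at hz
      have h := defectSum_eq ht hq0 hq σ K b hb hbK d ha hz.1 hz.2
      rw [defectSum, sum_add_distrib] at h
      rw [show z - 1 + 1 = z by ring]
      linear_combination stepWeight t σ (a - z) * h
    all_goals
      refine mul_eq_zero_of_right _ (sum_eq_zero fun f hf => ?_)
      rw [mem_Icc] at hf
    · rw [vertexWeight_of_neg q _ (by omega)]; simp
    · rw [vertexWeight_of_lt q (by omega)]; simp
    · rw [vertexWeight_of_neg q _ (by omega)]; simp
    · rw [vertexWeight_of_lt q (by omega)]; simp

/-! ### Linearization of products of continuous `q`-Hermite polynomials. -/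

/-- The right-hand side of the linearization formula of the continuous `q`-Hermite polynomials,
with `g m` in the place of the polynomial of degree `m`. -/
noncomputable def linearization (q : ℂ) (g : ℤ → ℂ) (B : ℕ) (a b : ℤ) : ℂ :=
  ∑ k ∈ range (B + 1),
    g (a + b - 2 * k) * (qPochInv q (a - k) * qPochInv q (b - k) * qPochInv q k)

theorem linearization_of_neg_left {q : ℂ} (hq0 : q ≠ 0) (g : ℤ → ℂ) (B : ℕ) {a : ℤ} (b : ℤ)
    (ha : a < 0) : linearization q g B a b = 0 :=
  sum_eq_zero fun k _ => by rw [qPochInv_of_neg hq0 (n := a - k) (by omega)]; simp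

theorem linearization_of_neg_right {q : ℂ} (hq0 : q ≠ 0) (g : ℤ → ℂ) (B : ℕ) (a : ℤ) {b : ℤ}
    (hb : b < 0) : linearization q g B a b = 0 :=
  sum_eq_zero fun k _ => by rw [qPochInv_of_neg hq0 (n := b - k) (by omega)]; simp

/-- The recurrence of `P(a, b) / ((q)_a (q)_b)`, checked for each value of `g`. With `X =
q^(a+1-k)`, `Y = q^(b+1-k)`, `Z = q^k` and common factors removed, both sides are `2 - X - Y - Z +
XYZ`. As `b < B`, shifting `k` loses no term. -/
theorem linearization_recurrence {q : ℂ} (hq0 : q ≠ 0) (hq : ‖q‖ < 1) (g : ℤ → ℂ) (B : ℕ)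
    (a b : ℤ) (hb : b < B) :
    (1 - q ^ (a + 1)) * linearization q g B (a + 1) b + linearization q g B (a - 1) b =
      (1 - q ^ (b + 1)) * linearization q g B a (b + 1) + linearization q g B a (b - 1) := by
  have shift : ∀ H : ℤ → ℂ, H 0 = 0 → H (B + 1) = 0 →
      ∑ k ∈ range (B + 1), H ((k : ℤ) + 1) = ∑ k ∈ range (B + 1), H k := by
    intro H h0 h1
    have e1 := sum_range_succ (fun k : ℕ => H k) (B + 1)
    have e2 := sum_range_succ' (fun k : ℕ => H k) (B + 1)
    push_cast at e1 e2
    rw [h1, add_zero] at e1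
    rw [h0, add_zero] at e2
    exact e2.symm.trans e1
  have s1 : linearization q g B (a - 1) b = ∑ k ∈ range (B + 1),
      g (a + b + 1 - 2 * k) *
        (qPochInv q (a - k) * qPochInv q (b + 1 - k) * qPochInv q ((k : ℤ) - 1)) := by
    rw [← shift (fun k => g (a + b + 1 - 2 * k) *
      (qPochInv q (a - k) * qPochInv q (b + 1 - k) * qPochInv q (k - 1)))
      (by simp [qPochInv_of_neg hq0 (n := -1)])
      (by simp [qPochInv_of_neg hq0 (n := b - B) (by omega)])]
    refine sum_congr rfl fun k _ => ?_
    congr 2 <;> ring_nf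
  have s2 : linearization q g B a (b - 1) = ∑ k ∈ range (B + 1),
      g (a + b + 1 - 2 * k) *
        (qPochInv q (a + 1 - k) * qPochInv q (b - k) * qPochInv q ((k : ℤ) - 1)) := by
    rw [← shift (fun k => g (a + b + 1 - 2 * k) *
      (qPochInv q (a + 1 - k) * qPochInv q (b - k) * qPochInv q (k - 1)))
      (by simp [qPochInv_of_neg hq0 (n := -1)])
      (by simp [qPochInv_of_neg hq0 (n := b - (B + 1)) (by omega)])]
    refine sum_congr rfl fun k _ => ?_
    congr 2 <;> ring_nf
  rw [s1, s2, linearization, linearization, mul_sum, mul_sum, ← sum_add_distrib,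
    ← sum_add_distrib]
  refine sum_congr rfl fun k _ => ?_
  rw [show a + 1 + b - 2 * (k : ℤ) = a + b + 1 - 2 * k by ring,
    show a + (b + 1) - 2 * (k : ℤ) = a + b + 1 - 2 * k by ring,
    show a - (k : ℤ) = (a + 1 - k) - 1 by ring, show b - (k : ℤ) = (b + 1 - k) - 1 by ring,
    qPochInv_sub_one hq0 hq, qPochInv_sub_one hq0 hq, qPochInv_sub_one hq0 hq]
  have ea : q ^ (a + 1) = q ^ (a + 1 - k) * q ^ (k : ℤ) := by
    rw [← zpow_add₀ hq0, sub_add_cancel]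
  have eb : q ^ (b + 1) = q ^ (b + 1 - k) * q ^ (k : ℤ) := by
    rw [← zpow_add₀ hq0, sub_add_cancel]
  rw [ea, eb]
  ring

/-- Both sides obey the same recurrence and agree at `b = 0`. Solving for `b + 1` calls on `a + 1`
at `b`, which preserves the bound `a + b ≤ K`. -/
theorem pathSum_eq_linearization {q t : ℂ} (ht : Complex.exp t = q) (hq0 : q ≠ 0) (hq : ‖q‖ < 1)
    (σ K : ℤ) (d B : ℕ) (b : ℕ) (a : ℤ) (ha : 0 ≤ a) (hB : b ≤ B) (hK : a + b ≤ K) :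
    pathSum q t σ K b d a * (qPochInv q a * qPochInv q b) =
      linearization q (pathSum q t σ K 0 d) B a b := by
  induction b using Nat.strong_induction_on generalizing a with
  | _ b ih =>
  rcases b with _ | b
  · rw [linearization, sum_eq_single 0]
    · simp [qPochInv_zero]
    · intro k _ hk
      rw [qPochInv_of_neg hq0 (n := ((0 : ℕ) : ℤ) - k) (by push_cast; omega)]
      simp
    · simp
  · push_cast at hK ⊢
    have hlin := linearization_recurrence hq0 hq (pathSum q t σ K 0 d) B a b (by omega)
    have hpath := pathSum_recurrence ht hq0 hq σ K d (b := b) ha (by omega) (by omega) (by omega)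
    have h1 := ih b (by omega) (a + 1) (by omega) (by omega) (by omega)
    have h2 : pathSum q t σ K b d (a - 1) * (qPochInv q (a - 1) * qPochInv q b) =
        linearization q (pathSum q t σ K 0 d) B (a - 1) b := by
      rcases ha.eq_or_lt with rfl | ha'
      · rw [linearization_of_neg_left hq0 _ _ _ (by omega), qPochInv_of_neg hq0 (by omega)]
        simp
      · exact ih b (by omega) (a - 1) (by omega) (by omega) (by omega)
    have h3 : pathSum q t σ K (b - 1) d a * (qPochInv q a * qPochInv q (b - 1)) =
        linearization q (pathSum q t σ K 0 d) B a (b - 1) := by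
      rcases b with _ | b
      · rw [linearization_of_neg_right hq0 _ _ _ (by simp), qPochInv_of_neg hq0 (n := _ - 1) (by simp)]
        simp
      · have := ih b (by omega) a (by omega) (by omega) (by push_cast at hK; omega)
        push_cast
        rw [add_sub_cancel_right]
        exact this
    have hne : 1 - q ^ ((b : ℤ) + 1) ≠ 0 := one_sub_zpow_ne_zero hq (by omega)
    have pa := qPochInv_sub_one hq0 hq a
    have pb := qPochInv_sub_one hq0 hq b
    have pa' := qPochInv_sub_one hq0 hq (a + 1)
    have pb' := qPochInv_sub_one hq0 hq ((b : ℤ) + 1)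
    rw [add_sub_cancel_right] at pa' pb'
    rw [← h1, ← h2, ← h3, pa, pb] at hlin
    apply mul_left_cancel₀ hne
    linear_combination hlin - qPochInv q a * qPochInv q b * hpath -
      pathSum q t σ K (b + 1) d a * qPochInv q a * pb' +
      pathSum q t σ K b d (a + 1) * qPochInv q b * pa'

/-! ### The inverse Cartan matrix as a discrete Green's operator. -/

/-- `C` is minus the second difference; letting `x` live on all of `ℕ` supplies the end values `x 0`
and `x (d + 1)`, which the last two terms correct for. -/
theorem cartan_mulVec {R : Type*} [CommRing R] (d : ℕ) (x : ℕ → R) (j : Fin d) :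
    ((CartanMatrix.A d).map (Int.cast : ℤ → R)).mulVec (fun i => x (i + 1)) j =
      2 * x (j + 1) - x j - x (j + 2) + (if (j : ℕ) = 0 then x 0 else 0) +
        (if (j : ℕ) + 1 = d then x (d + 1) else 0) := by
  have hj := j.isLt
  have hA : ∀ i : Fin d, ((CartanMatrix.A d j i : ℤ) : R) * x (i + 1) =
      (if (i : ℕ) = j then 2 * x (i + 1) else 0) - (if (i : ℕ) + 1 = j then x (i + 1) else 0)
      - (if (i : ℕ) = (j : ℕ) + 1 then x (i + 1) else 0) := by
    intro i
    simp only [CartanMatrix.A, Matrix.of_apply, Fin.ext_iff]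
    split_ifs <;> first | omega | (push_cast; ring)
  simp only [Matrix.mulVec, dotProduct, Matrix.map_apply]
  rw [Finset.sum_congr rfl fun i _ => hA i,
    Fin.sum_univ_eq_sum_range (fun i : ℕ =>
      (if i = (j : ℕ) then 2 * x (i + 1) else 0) - (if i + 1 = (j : ℕ) then x (i + 1) else 0)
      - (if i = (j : ℕ) + 1 then x (i + 1) else 0)),
    Finset.sum_sub_distrib, Finset.sum_sub_distrib, Finset.sum_ite_eq', Finset.sum_ite_eq']
  have h2 : ∑ i ∈ Finset.range d, (if i + 1 = (j : ℕ) then x (i + 1) else 0)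
      = x j - (if (j : ℕ) = 0 then x 0 else 0) := by
    rcases Nat.eq_zero_or_pos (j : ℕ) with h0 | h0
    · simp [h0]
    · obtain ⟨k, hk⟩ : ∃ k, (j : ℕ) = k + 1 := ⟨j - 1, by omega⟩
      have : k < d := by omega
      simp only [hk, Nat.add_right_cancel_iff]
      rw [Finset.sum_ite_eq' (Finset.range d) k (fun i : ℕ => x (i + 1))]
      simp [this]
  rw [h2]
  simp only [Finset.mem_range, hj, if_true]
  by_cases h : (j : ℕ) + 1 = d
  · have h' : ¬ (j : ℕ) + 1 < d := by omega
    have hx : x (d + 1) = x (j + 2) := by rw [show d + 1 = (j : ℕ) + 2 by omega]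
    rw [if_pos h, hx]
    simp only [h', if_false]
    ring
  · have h' : (j : ℕ) + 1 < d := by omega
    simp only [h, h', if_true, if_false]
    ring

/-- A kernel vector extended by zeros has vanishing second differences, so it is linear; being zero
at both ends, it is zero. -/
theorem cartan_det_ne_zero (d : ℕ) :
    ((CartanMatrix.A d).map (Int.cast : ℤ → ℚ)).det ≠ 0 := by
  intro hdet
  obtain ⟨v, hv0, hv⟩ := Matrix.exists_mulVec_eq_zero_iff.2 hdet
  apply hv0
  set x : ℕ → ℚ := fun k => if h : 0 < k ∧ k - 1 < d then v ⟨k - 1, h.2⟩ else 0 with hx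
  have hxv : (fun i : Fin d => x (i + 1)) = v := by
    funext i; simp [hx]
  have hrec : ∀ j : Fin d, x (j + 2) = 2 * x (j + 1) - x j := by
    intro j
    have h := cartan_mulVec d x j
    rw [hxv, hv] at h
    have h0 : x 0 = 0 := by simp [hx]
    have h1 : x (d + 1) = 0 := by simp [hx]
    rw [h0, h1] at h
    simp at h
    linarith
  have hlin : ∀ k : ℕ, k ≤ d → x k = k * x 1 ∧ x (k + 1) = (k + 1) * x 1 := by
    intro k
    induction k with
    | zero => intro _; simp [hx]
    | succ k ih =>
      intro hk
      obtain ⟨h1, h2⟩ := ih (by omega)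
      have h3 := hrec ⟨k, by omega⟩
      simp only at h3
      refine ⟨by rw [h2]; push_cast; ring, ?_⟩
      rw [show k + 1 + 1 = k + 2 by ring, h3, h1, h2]
      push_cast
      ring
  have hd := (hlin d le_rfl).2
  rw [show x (d + 1) = 0 by simp [hx]] at hd
  have hx1 : x 1 = 0 := by
    rcases mul_eq_zero.1 hd.symm with h | h
    · have : (0 : ℚ) < d + 1 := by positivity
      exact absurd h this.ne'
    · exact h
  rw [← hxv]
  funext i
  have := (hlin i i.isLt.le).2
  rw [this, hx1]
  simp

theorem cartanInv_eq (d : ℕ) (n : Fin d → ℤ) (y : ℕ → ℚ) (h0 : y 0 = 0) (h1 : y (d + 1) = 0)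
    (h : ∀ j : Fin d, (n j : ℚ) = 2 * y (j + 1) - y j - y (j + 2)) :
    cartanInv d n = fun j : Fin d => y (j + 1) := by
  have hn : (fun j => (n j : ℚ)) =
      ((CartanMatrix.A d).map (Int.cast : ℤ → ℚ)).mulVec (fun j : Fin d => y (j + 1)) := by
    funext j
    rw [cartan_mulVec, h, h0, h1]
    simp
  rw [cartanInv, hn, Matrix.mulVec_mulVec, Matrix.nonsing_inv_mul _
    (isUnit_iff_ne_zero.2 (cartan_det_ne_zero d)), Matrix.one_mulVec]

/-! ### Solutions of the system as paths. -/

/-- The vertices of the path from `a` to `b` with interior vertices `m`. -/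
def pathVertex (d : ℕ) (a b : ℤ) (m : Fin d → ℤ) : ℕ → ℤ
  | 0 => a
  | j + 1 => if h : j < d then m ⟨j, h⟩ else b

theorem pathVertex_zero (d : ℕ) (a b : ℤ) (m : Fin d → ℤ) : pathVertex d a b m 0 = a := rfl

theorem pathVertex_succ (d : ℕ) (a b : ℤ) (m : Fin d → ℤ) (j : Fin d) :
    pathVertex d a b m (j + 1) = m j := by
  simp [pathVertex]

theorem pathVertex_last (d : ℕ) (a b : ℤ) (m : Fin d → ℤ) : pathVertex d a b m (d + 1) = b := by
  simp [pathVertex]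

theorem pathVertex_cons (d : ℕ) (a b c : ℤ) (m : Fin d → ℤ) (j : ℕ) :
    pathVertex (d + 1) a b (Fin.cons c m) (j + 1) = pathVertex d c b m j := by
  cases j with
  | zero => simp [pathVertex]
  | succ j =>
    by_cases h : j < d
    · simp only [pathVertex, h, Nat.add_lt_add_iff_right, dite_true]
      exact Fin.cons_succ (α := fun _ => ℤ) c m ⟨j, h⟩
    · simp [pathVertex, h]

theorem system_iff (d : ℕ) (a b : ℤ) (m n : Fin d → ℤ) :
    System d (a • eFirst d + b • eLast d) m n ↔
      ∀ j : Fin d, 2 * (m j + n j) = pathVertex d a b m j + pathVertex d a b m (j + 2) := by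
  unfold System
  refine forall_congr' fun j => ?_
  have h := cartan_mulVec d (pathVertex d a b m) j
  have hm : (fun i : Fin d => pathVertex d a b m (i + 1)) = m :=
    funext fun i => pathVertex_succ d a b m i
  have hA : (CartanMatrix.A d).map (Int.cast : ℤ → ℤ) = CartanMatrix.A d := by ext; simp
  rw [hm, hA, pathVertex_succ, pathVertex_last, pathVertex_zero] at h
  rw [Matrix.sub_mulVec, Pi.sub_apply, h, Matrix.ofNat_mulVec]
  simp only [Pi.smul_apply, Pi.add_apply, eFirst, eLast, smul_eq_mul, mul_ite, mul_one, mul_zero]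
  constructor <;> intro h' <;> linarith

/-- The path `C⁻¹ n` for the system with interior vertices `m`. -/
def dualVertex (d : ℕ) (a b : ℤ) (m : Fin d → ℤ) (k : ℕ) : ℚ :=
  ((a : ℚ) + ((b : ℚ) - a) * k / (d + 1) - pathVertex d a b m k) / 2

theorem dualVertex_zero (d : ℕ) (a b : ℤ) (m : Fin d → ℤ) : dualVertex d a b m 0 = 0 := by
  simp [dualVertex, pathVertex_zero]

theorem dualVertex_last (d : ℕ) (a b : ℤ) (m : Fin d → ℤ) : dualVertex d a b m (d + 1) = 0 := by
  have : (d : ℚ) + 1 ≠ 0 := by positivity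
  simp only [dualVertex, pathVertex_last]
  push_cast
  field_simp
  ring

/-- The chord has no second difference and meets the path at both ends, so `dualVertex` solves the
Dirichlet problem with source `n`. -/
theorem cartanInv_of_system {d : ℕ} {a b : ℤ} {m n : Fin d → ℤ}
    (h : System d (a • eFirst d + b • eLast d) m n) :
    cartanInv d n = fun j : Fin d => dualVertex d a b m (j + 1) := by
  refine cartanInv_eq d n _ (dualVertex_zero d a b m) (dualVertex_last d a b m) fun j => ?_
  have hj := (system_iff d a b m n).1 h j
  rw [← pathVertex_succ d a b m j] at hj
  have hj' : (2 : ℚ) * (pathVertex d a b m (j + 1) + n j) =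
    pathVertex d a b m j + pathVertex d a b m (j + 2) := by exact_mod_cast hj
  have : (d : ℚ) + 1 ≠ 0 := by positivity
  simp only [dualVertex]
  push_cast
  field_simp
  linear_combination ((d : ℚ) + 1) * hj'

theorem cartanInvFirst_of_system {d : ℕ} {a b : ℤ} {m n : Fin d → ℤ}
    (h : System d (a • eFirst d + b • eLast d) m n) :
    cartanInvFirst d n = dualVertex d a b m 1 := by
  rw [cartanInvFirst, cartanInv_of_system h]
  cases d with
  -- Without interior vertices, index `1` is already the end of the path, where `dualVertex`
  -- vanishes.
  | zero => simpa using (dualVertex_last 0 a b m).symm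
  | succ d =>
    rw [Finset.sum_eq_single 0]
    · simp [eFirst]
    · intro j _ hj
      simp [eFirst, Fin.val_ne_zero_iff.2 hj]
    · simp

theorem sum_by_parts (δ Y : ℕ → ℚ) (d : ℕ) :
    ∑ j ∈ range d, (δ (j + 1) - δ j) * Y (j + 1) =
      δ d * Y (d + 1) - ∑ j ∈ range (d + 1), δ j * (Y (j + 1) - Y j) - δ 0 * Y 0 := by
  induction d with
  | zero => simp; ring
  | succ d ih =>
    rw [sum_range_succ, ih, sum_range_succ _ (d + 1)]
    ring

/-- Summation by parts moves one difference from the path onto `dualVertex`, whose steps are half of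
the chord slope minus the path step; the slope terms telescope. -/
theorem cartanInvForm_of_system {d : ℕ} {a b : ℤ} {m n : Fin d → ℤ}
    (h : System d (a • eFirst d + b • eLast d) m n) :
    cartanInvForm d n =
      ∑ j ∈ range (d + 1), (((pathVertex d a b m j - pathVertex d a b m (j + 1) : ℤ) : ℚ) ^ 2 / 4) -
        ((a - b : ℤ) : ℚ) ^ 2 / (4 * (d + 1)) := by
  set x : ℕ → ℚ := fun k => pathVertex d a b m k with hx
  have hd : (d : ℚ) + 1 ≠ 0 := by positivity
  have hn : ∀ j : Fin d, (n j : ℚ) * dualVertex d a b m (j + 1) =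
      (fun k : ℕ => ((x (k + 1 + 1) - x (k + 1)) - (x (k + 1) - x k)) * dualVertex d a b m (k + 1))
        j * (1 / 2) := by
    intro j
    have hj := (system_iff d a b m n).1 h j
    rw [← pathVertex_succ d a b m j] at hj
    have hj' : (2 : ℚ) * (x (j + 1) + n j) = x j + x (j + 2) := by
      simp only [hx]; exact_mod_cast hj
    simp only
    linear_combination (1 / 2) * dualVertex d a b m (j + 1) * hj'
  rw [cartanInvForm, cartanInv_of_system h]
  simp only [hn]
  rw [Fin.sum_univ_eq_sum_range (fun k : ℕ =>
    ((x (k + 1 + 1) - x (k + 1)) - (x (k + 1) - x k)) * dualVertex d a b m (k + 1) * (1 / 2)),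
    ← sum_mul, sum_by_parts (fun k => x (k + 1) - x k), dualVertex_zero, dualVertex_last]
  have hstep : ∀ j, dualVertex d a b m (j + 1) - dualVertex d a b m j =
      (((b : ℚ) - a) / (d + 1) - (x (j + 1) - x j)) / 2 := by
    intro j
    simp only [dualVertex, hx]
    push_cast
    field_simp
    ring
  have hsq : ∀ j, (x (j + 1) - x j) * (dualVertex d a b m (j + 1) - dualVertex d a b m j) =
      (x (j + 1) - x j) * (((b : ℚ) - a) / (2 * (d + 1))) -
        2 * (((pathVertex d a b m j - pathVertex d a b m (j + 1) : ℤ) : ℚ) ^ 2 / 4) := by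
    intro j
    rw [hstep]
    simp only [hx]
    push_cast
    field_simp
    ring
  simp only [hsq]
  rw [sum_sub_distrib, ← sum_mul, sum_range_sub, ← mul_sum]
  simp only [hx, pathVertex_last, pathVertex_zero]
  push_cast
  field_simp
  ring

/-! ### Fermionic sums as path sums. -/

/-- The product of the weights of the steps and of the interior vertices of a path. -/
noncomputable def pathWeight (q t : ℂ) (σ : ℤ) (d : ℕ) (a b : ℤ) (m : Fin d → ℤ) : ℂ :=
  (∏ j ∈ range (d + 1), stepWeight t σ (pathVertex d a b m j - pathVertex d a b m (j + 1))) *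
    ∏ j ∈ range d, vertexWeight q (pathVertex d a b m j + pathVertex d a b m (j + 2))
      (pathVertex d a b m (j + 1))

theorem sum_piFinset_cons (d : ℕ) (S : Finset ℤ) (f : (Fin (d + 1) → ℤ) → ℂ) :
    ∑ m ∈ Fintype.piFinset (fun _ : Fin (d + 1) => S), f m =
      ∑ c ∈ S, ∑ m ∈ Fintype.piFinset (fun _ : Fin d => S), f (Fin.cons c m) := by
  rw [← Finset.sum_product']
  refine (Finset.sum_bij' (fun p _ => Fin.cons p.1 p.2) (fun m _ => (m 0, Fin.tail m))
    ?_ ?_ ?_ ?_ ?_).symm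
  · intro p hp
    rw [mem_product, Fintype.mem_piFinset] at hp
    rw [Fintype.mem_piFinset]
    intro i
    refine Fin.cases ?_ (fun i => ?_) i
    · simpa using hp.1
    · simpa using hp.2 i
  · intro m hm
    rw [Fintype.mem_piFinset] at hm
    rw [mem_product, Fintype.mem_piFinset]
    exact ⟨hm 0, fun i => hm i.succ⟩
  · intro p _; simp
  · intro m _; simp
  · intro p _; rfl

theorem tailSum_succ_eq_sum (q t : ℂ) (σ K : ℤ) {b : ℤ} (hb : 0 ≤ b) (hbK : b ≤ K) (d : ℕ)
    (a c : ℤ) :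
    tailSum q t σ K b (d + 1) a c = ∑ m ∈ Fintype.piFinset (fun _ : Fin d => Icc 0 K),
      vertexWeight q (a + pathVertex d c b m 1) c * pathWeight q t σ d c b m := by
  induction d generalizing a c with
  | zero => simp [tailSum, pathWeight, pathVertex, hb, hbK]
  | succ d ih =>
    rw [tailSum_succ, sum_piFinset_cons]
    refine sum_congr rfl fun e _ => ?_
    rw [ih, mul_sum]
    refine sum_congr rfl fun m _ => ?_
    simp only [pathWeight, prod_range_succ' _ (d + 1), prod_range_succ' _ d, pathVertex_cons,
      pathVertex_zero, zero_add, pathVertex_cons d c b e m 0]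
    ring

theorem pathSum_eq_sum (q t : ℂ) (σ K : ℤ) {b : ℤ} (hb : 0 ≤ b) (hbK : b ≤ K) (d : ℕ) (a : ℤ) :
    pathSum q t σ K b d a =
      ∑ m ∈ Fintype.piFinset (fun _ : Fin d => Icc 0 K), pathWeight q t σ d a b m := by
  cases d with
  | zero => simp [pathSum, tailSum, pathWeight, pathVertex, hb, hbK]
  | succ d =>
    rw [pathSum, sum_piFinset_cons]
    refine sum_congr rfl fun c _ => ?_
    rw [tailSum_succ_eq_sum q t σ K hb hbK, mul_sum]
    refine sum_congr rfl fun m _ => ?_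
    simp only [pathWeight, prod_range_succ' _ (d + 1), prod_range_succ' _ d, pathVertex_cons,
      pathVertex_zero, zero_add]
    ring

/-- Maximum principle for convex sequences: once the sequence rises above `K`, it keeps rising up to
the right end. For paths, convexity is `0 ≤ n`, so every nonzero summand has its vertices below the
bound of the ends. -/
theorem le_of_midpoint_le {x : ℕ → ℤ} {d : ℕ} {K : ℤ}
    (hx : ∀ j < d, 2 * x (j + 1) ≤ x j + x (j + 2)) (h0 : x 0 ≤ K) (h1 : x (d + 1) ≤ K)
    {j : ℕ} (hj : j ≤ d + 1) : x j ≤ K := by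
  induction j with
  | zero => exact h0
  | succ k ih =>
    have hk := ih (by omega)
    by_contra! hlt
    have hinc : ∀ i, k + 1 + i ≤ d + 1 → x (k + i) ≤ x (k + 1 + i) ∧ K < x (k + 1 + i) := by
      intro i
      induction i with
      | zero => intro _; exact ⟨by simpa using hk.trans hlt.le, hlt⟩
      | succ i ih' =>
        intro hi
        obtain ⟨h2, h3⟩ := ih' (by omega)
        have h4 := hx (k + i) (by omega)
        rw [show k + 1 + i = k + i + 1 by ring] at h2 h3
        rw [show k + 1 + (i + 1) = k + i + 2 by ring, show k + (i + 1) = k + i + 1 by ring]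
        omega
    have := (hinc (d - k) (by omega)).2
    rw [show k + 1 + (d - k) = d + 1 by omega] at this
    omega

theorem prod_qPow (t : ℂ) (f : ℕ → ℚ) (d : ℕ) :
    ∏ j ∈ range d, qPow t (f j) = qPow t (∑ j ∈ range d, f j) := by
  induction d with
  | zero => simp [qPow_zero]
  | succ d ih => rw [prod_range_succ, sum_range_succ, qPow_add, ih]

/-- The vector `n` which together with `m` solves the system, provided that the sums of the
neighbours on the path are even. -/
def complementVector (d : ℕ) (a b : ℤ) (m : Fin d → ℤ) : Fin d → ℤ := fun j =>
  (pathVertex d a b m j + pathVertex d a b m (j + 2)) / 2 - m j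

/-- All steps of the path are congruent to `σ` modulo `2`. -/
def StepParity (σ : ℤ) (d : ℕ) (a b : ℤ) (m : Fin d → ℤ) : Prop :=
  ∀ j < d + 1, Even (pathVertex d a b m j - pathVertex d a b m (j + 1) + σ)

theorem StepParity.even_add {σ : ℤ} {d : ℕ} {a b : ℤ} {m : Fin d → ℤ}
    (h : StepParity σ d a b m) {j : ℕ} (hj : j < d) :
    Even (pathVertex d a b m j + pathVertex d a b m (j + 2)) := by
  have h1 := h j (by omega)
  have h2 := h (j + 1) (by omega)
  rw [Int.even_iff] at *
  rw [show j + 1 + 1 = j + 2 by ring] at h2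
  omega

theorem StepParity.system {σ : ℤ} {d : ℕ} {a b : ℤ} {m : Fin d → ℤ}
    (h : StepParity σ d a b m) :
    System d (a • eFirst d + b • eLast d) m (complementVector d a b m) := by
  rw [system_iff]
  intro j
  have := h.even_add j.isLt
  rw [Int.even_iff] at this
  simp only [complementVector]
  omega

/-- The rational number in question is half of the first step plus `σ`; the system makes neighbour
sums even, so the parity of the first step spreads to all. -/
theorem stepParity_iff {σ : ℤ} {d : ℕ} {a b : ℤ} {m n : Fin d → ℤ}
    (h : System d (a • eFirst d + b • eLast d) m n) :
    StepParity σ d a b m ↔ ∃ z : ℤ,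
      ((a - b + σ * (d + 1) : ℤ) : ℚ) / (2 * ((d : ℚ) + 1)) + cartanInvFirst d n = z := by
  have hd : (d : ℚ) + 1 ≠ 0 := by positivity
  have e : ((a - b + σ * (d + 1) : ℤ) : ℚ) / (2 * ((d : ℚ) + 1)) + cartanInvFirst d n =
      ((pathVertex d a b m 0 - pathVertex d a b m 1 + σ : ℤ) : ℚ) / 2 := by
    rw [cartanInvFirst_of_system h, dualVertex, pathVertex_zero]
    push_cast
    field_simp
    ring
  rw [e]
  have e2 : (∃ z : ℤ, ((pathVertex d a b m 0 - pathVertex d a b m 1 + σ : ℤ) : ℚ) / 2 = z) ↔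
      Even (pathVertex d a b m 0 - pathVertex d a b m 1 + σ) := by
    constructor
    · rintro ⟨z, hz⟩
      refine ⟨z, ?_⟩
      rw [div_eq_iff two_ne_zero] at hz
      have : pathVertex d a b m 0 - pathVertex d a b m 1 + σ = z * 2 := by exact_mod_cast hz
      omega
    · rintro ⟨z, hz⟩
      refine ⟨z, ?_⟩
      rw [hz]
      push_cast
      ring
  rw [e2]
  refine ⟨fun hp => hp 0 (by omega), fun h0 j => ?_⟩
  induction j with
  | zero => intro _; exact h0
  | succ j ih =>
    intro hj
    have h1 := ih (by omega)
    have h2 := (system_iff d a b m n).1 h ⟨j, by omega⟩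
    simp only at h2
    rw [Int.even_iff] at *
    rw [show j + 1 + 1 = j + 2 by ring]
    omega

theorem pathWeight_of_not_stepParity (q t : ℂ) {σ : ℤ} {d : ℕ} {a b : ℤ} {m : Fin d → ℤ}
    (h : ¬ StepParity σ d a b m) : pathWeight q t σ d a b m = 0 := by
  unfold StepParity at h
  push Not at h
  obtain ⟨j, hj, hodd⟩ := h
  refine mul_eq_zero_of_left (prod_eq_zero (mem_range.2 hj) ?_) _
  rw [stepWeight, if_neg hodd]

theorem fermionicTerm_eq (q t : ℂ) {σ : ℤ} {d : ℕ} {a b : ℤ} {m : Fin d → ℤ}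
    (h : StepParity σ d a b m) :
    fermionicTerm q t d m (complementVector d a b m) =
      qPow t (-(((a - b : ℤ) : ℚ) ^ 2 / (4 * (d + 1)))) * pathWeight q t σ d a b m := by
  rw [fermionicTerm, cartanInvForm_of_system h.system, sub_eq_neg_add, qPow_add, mul_assoc,
    pathWeight, ← prod_qPow]
  congr 2
  · exact prod_congr rfl fun j hj => by rw [stepWeight, if_pos (h j (mem_range.1 hj))]
  · rw [← Fin.prod_univ_eq_prod_range (fun j : ℕ =>
      vertexWeight q (pathVertex d a b m j + pathVertex d a b m (j + 2))
      (pathVertex d a b m (j + 1)))]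
    refine prod_congr rfl fun j _ => ?_
    rw [vertexWeight, if_pos (h.even_add j.isLt), gaussBinom, pathVertex_succ]
    rfl

/-- The fermionic sums are path sums. -/
theorem fermionicSum_eq (q t : ℂ) (σ K : ℤ) (d : ℕ) {a b : ℤ} (haK : a ≤ K) (hb : 0 ≤ b)
    (hbK : b ≤ K) :
    fermionicSum q t d (a • eFirst d + b • eLast d)
        (((a - b + σ * (d + 1) : ℤ) : ℚ) / (2 * ((d : ℚ) + 1))) =
      qPow t (-(((a - b : ℤ) : ℚ) ^ 2 / (4 * (d + 1)))) * pathSum q t σ K b d a := by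
  classical
  rw [fermionicSum, finsum_mem_eq_sum_of_inter_support_eq
    (t := ((Fintype.piFinset (fun _ : Fin d => Icc 0 K)).filter (StepParity σ d a b)).image
      (fun m => (m, complementVector d a b m)))]
  · rw [sum_image (fun m _ m' _ h => (Prod.ext_iff.1 h).1), sum_filter,
      pathSum_eq_sum q t σ K hb hbK, mul_sum]
    refine sum_congr rfl fun m _ => ?_
    split_ifs with h
    · exact fermionicTerm_eq q t h
    · rw [pathWeight_of_not_stepParity q t h, mul_zero]
  · ext ⟨m, n⟩
    simp only [Set.mem_inter_iff, Set.mem_ofPred_eq, Function.mem_support, coe_image, coe_filter,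
      Set.mem_image, Prod.mk.injEq, and_congr_left_iff]
    intro hne
    constructor
    · rintro ⟨hsys, hz⟩
      have hpos : ∀ j, 0 ≤ m j ∧ 0 ≤ n j := by
        intro j
        by_contra hc
        apply hne
        have : ∏ j, qBinom q (m j) (n j) = 0 :=
          Finset.prod_eq_zero (Finset.mem_univ j) (by rw [qBinom, if_neg hc])
        rw [fermionicTerm, this, mul_zero]
      have hj := (system_iff d a b m n).1 hsys
      have hle : ∀ j, m j ≤ K := by
        intro j
        rw [← pathVertex_succ d a b m j]
        refine le_of_midpoint_le (d := d) (fun i hi => ?_) haK ?_ (by omega)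
        · have h1 := hj ⟨i, hi⟩
          have h2 := (hpos ⟨i, hi⟩).2
          rw [← pathVertex_succ d a b m ⟨i, hi⟩] at h1
          simp only at h1
          omega
        · rwa [pathVertex_last]
      refine ⟨m, ⟨?_, (stepParity_iff hsys).2 hz⟩, rfl, ?_⟩
      · rw [Fintype.mem_piFinset]
        exact fun j => mem_Icc.2 ⟨(hpos j).1, hle j⟩
      · funext j
        have := hj j
        simp only [complementVector]
        omega
    · rintro ⟨m', ⟨_, hp⟩, rfl, rfl⟩
      exact ⟨hp.system, (stepParity_iff hp.system).1 hp⟩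

/-! ### The summation identity. -/

/-- Since `a - b = 2 L + ℓ`, the prefactor cancels all of `(a - b)² / (4 N)` except `ℓ² / (4 N)`, a
constant common to both sides of the identity. -/
theorem etaSum_eq (q t : ℂ) {N : ℕ} (hN : 1 ≤ N) (σ ℓ M L K : ℤ) (ha : M + L + ℓ ≤ K)
    (hb : 0 ≤ M - L) (hbK : M - L ≤ K) :
    qPow t ((L * (L + ℓ) : ℤ) / (N : ℚ)) * etaSum q t N σ ℓ M L =
      qPow t (-((ℓ : ℚ) ^ 2 / (4 * N))) *
        pathSum q t σ K (M - L) (N - 1) (M + L + ℓ) := by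
  obtain ⟨d, rfl⟩ : ∃ d, N = d + 1 := ⟨N - 1, by omega⟩
  have hd : (d : ℚ) + 1 ≠ 0 := by positivity
  have h := fermionicSum_eq q t σ K d ha hb hbK
  rw [etaSum, Nat.add_sub_cancel]
  push_cast at h ⊢
  rw [show (2 : ℚ) * L + ℓ + σ * (d + 1) = (M + L + ℓ - (M - L) + σ * (d + 1)) by ring, h,
    ← mul_assoc, ← qPow_add]
  congr 2
  field_simp
  ring

theorem nSum_eq (q t : ℂ) {N : ℕ} (hN : 1 ≤ N) (σ ℓ i K : ℤ) (hK : 2 * i + ℓ ≤ K)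
    (hK0 : 0 ≤ K) :
    qPow t ((i * (i + ℓ) : ℤ) / (N : ℚ)) * nSum q t N σ ℓ i =
      qPow t (-((ℓ : ℚ) ^ 2 / (4 * N))) * pathSum q t σ K 0 (N - 1) (2 * i + ℓ) := by
  have h := etaSum_eq q t hN σ ℓ i i K (by omega) (by omega) (by omega)
  rw [show i + i + ℓ = 2 * i + ℓ by ring, sub_self] at h
  rw [← h, nSum, etaSum, show i + i + ℓ = 2 * i + ℓ by ring, sub_self, zero_smul, add_zero]

theorem sum_nSum_eq_etaSum {q t : ℂ} (hq : ‖q‖ < 1) (ht : Complex.exp t = q)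
    {N : ℕ} (hN : 1 ≤ N) (σ ℓ M L : ℤ) :
    ∑ i ∈ Icc L M,
        qPow t ((i * (i + ℓ) : ℤ) / (N : ℚ)) /
            (qPoch q q (i - L) * qPoch q q (i + L + ℓ) * qPoch q q (M - i)) *
          nSum q t N σ ℓ i =
      qPow t ((L * (L + ℓ) : ℤ) / (N : ℚ)) / (qPoch q q (M - L) * qPoch q q (M + L + ℓ)) *
        etaSum q t N σ ℓ M L := by
  have hq0 : q ≠ 0 := ht ▸ Complex.exp_ne_zero t
  rcases lt_or_ge M L with hML | hML
  · rw [Icc_eq_empty_of_lt hML, qPoch_of_neg q hq0 (n := M - L) (by omega)]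
    simp
  rcases lt_or_ge (M + L + ℓ) 0 with hneg | hpos
  · rw [qPoch_of_neg q hq0 (n := M + L + ℓ) hneg, sum_eq_zero]
    · simp
    · intro i hi
      rw [mem_Icc] at hi
      rw [qPoch_of_neg q hq0 (n := i + L + ℓ) (by omega)]
      simp
  obtain ⟨b, hb⟩ := Int.eq_ofNat_of_zero_le (a := M - L) (by omega)
  have hlin := pathSum_eq_linearization ht hq0 hq σ (M + L + ℓ + b) (N - 1) b b (M + L + ℓ) hpos
    le_rfl le_rfl
  have heta := etaSum_eq q t hN σ ℓ M L (M + L + ℓ + b) (by omega) (by omega) (by omega)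
  rw [hb] at heta
  calc _ = ∑ i ∈ Icc L M, qPow t (-((ℓ : ℚ) ^ 2 / (4 * N))) *
        (pathSum q t σ (M + L + ℓ + b) 0 (N - 1) (2 * i + ℓ) *
          (qPochInv q (i + L + ℓ) * qPochInv q (i - L) * qPochInv q (M - i))) := by
        refine sum_congr rfl fun i hi => ?_
        rw [mem_Icc] at hi
        rw [← mul_assoc, ← nSum_eq q t hN σ ℓ i (M + L + ℓ + b) (by omega) (by omega)]
        simp only [qPochInv, div_eq_mul_inv, mul_inv]
        ring
    _ = qPow t (-((ℓ : ℚ) ^ 2 / (4 * N))) *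
        linearization q (pathSum q t σ (M + L + ℓ + b) 0 (N - 1)) b (M + L + ℓ) b := by
        rw [← mul_sum, linearization]
        congr 1
        -- With `k = M - i`, the entries `a + b - 2 k`, `a - k`, `b - k` become `2 i + ℓ`, `i + L +
        -- ℓ`, `i - L`.
        refine sum_bij' (fun i _ => (M - i).toNat) (fun k _ => M - (k : ℤ)) ?_ ?_ ?_ ?_ ?_
        · intro i hi
          rw [mem_Icc] at hi
          rw [mem_range]
          omega
        · intro k hk
          rw [mem_range] at hk
          rw [mem_Icc]
          omega
        · intro i hi
          rw [mem_Icc] at hi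
          omega
        · intro k hk
          simp
        · intro i hi
          rw [mem_Icc] at hi
          rw [Int.toNat_of_nonneg (by omega), ← hb,
            show M + L + ℓ + (M - L) - 2 * (M - i) = 2 * i + ℓ by ring,
            show M + L + ℓ - (M - i) = i + L + ℓ by ring, show M - L - (M - i) = i - L by ring]
    _ = _ := by
        rw [← hlin, ← mul_assoc, ← heta, ← hb]
        simp only [qPochInv, div_eq_mul_inv, mul_inv]
        ring

/-! ### The conjugate Bailey pair and its consequence. -/

theorem qPoch_zpow_mul {q : ℂ} (hq0 : q ≠ 0) {ℓ : ℤ} (hℓ : 0 ≤ ℓ) {n : ℤ} (hn : 0 ≤ n) :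
    qPoch q q (n + ℓ) = qPoch q q ℓ * qPoch q (q ^ ℓ * q) n := by
  induction n, hn using Int.leInduction with
  | base => simp [qPoch_zero]
  | succ n hn ih =>
    rw [show n + 1 + ℓ = n + ℓ + 1 by ring, qPoch_succ q q (by omega), ih, qPoch_succ _ _ hn,
      mul_assoc, mul_assoc (q ^ ℓ), ← zpow_one_add₀ hq0, ← zpow_one_add₀ hq0, ← zpow_add₀ hq0,
      show ℓ + (1 + n) = 1 + (n + ℓ) by ring]

theorem prefactor_eq (t : ℂ) (N : ℕ) (ℓ L : ℤ) :
    prefactor t N ℓ L = qPow t ((L * (L + ℓ) : ℤ) / (N : ℚ)) := by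
  rw [prefactor, ← qPow_add]
  congr 1
  push_cast
  ring

theorem deltaSeq_of_lt {q : ℂ} (hq0 : q ≠ 0) (t : ℂ) (N : ℕ) (σ ℓ : ℤ) {M : ℤ} {L : ℕ}
    (h : M < L) : deltaSeq q t N σ ℓ M L = 0 := by
  rw [deltaSeq, qPoch_of_neg q hq0 (n := M - L) (by omega)]
  simp

theorem gammaSeq_of_lt {q : ℂ} (hq0 : q ≠ 0) (t : ℂ) (N : ℕ) (σ ℓ : ℤ) {M : ℤ} {L : ℕ}
    (h : M < L) : gammaSeq q t N σ ℓ M L = 0 := by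
  rw [gammaSeq, qPoch_of_neg q hq0 (n := M - L) (by omega)]
  simp

theorem gammaSeq_eq_sum {q t : ℂ} (hq : ‖q‖ < 1) (ht : Complex.exp t = q)
    {N : ℕ} (hN : 1 ≤ N) (σ ℓ M : ℤ) (hℓ : 0 ≤ ℓ) (L : ℕ) :
    gammaSeq q t N σ ℓ M L = ∑ r ∈ Icc L M.toNat, deltaSeq q t N σ ℓ M r /
      (qPoch q q ((r : ℤ) - L) * qPoch q (q ^ ℓ * q) ((r : ℤ) + L)) := by
  have hq0 : q ≠ 0 := ht ▸ Complex.exp_ne_zero t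
  rcases lt_or_ge M L with hML | hML
  · rw [gammaSeq_of_lt hq0 t N σ ℓ hML, sum_eq_zero]
    intro r hr
    rw [mem_Icc] at hr
    rw [deltaSeq_of_lt hq0 t N σ ℓ (by omega), zero_div]
  have hmain := sum_nSum_eq_etaSum hq ht hN σ ℓ M L
  have hne := qPoch_ne_zero hq0 hq hℓ
  -- The factor `(q)_ℓ` turns each `(q)_{n+ℓ}` in a denominator into `(aq)_n`.
  have hmain' := congrArg (fun z => qPoch q q ℓ * z) hmain
  rw [qPoch_zpow_mul hq0 hℓ (n := M + L) (by omega), mul_sum] at hmain'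
  rw [gammaSeq, prefactor_eq]
  calc _ = _ := by field_simp
    _ = _ := hmain'.symm
    _ = _ := by
      refine sum_bij' (fun i _ => i.toNat) (fun r _ => (r : ℤ)) ?_ ?_ ?_ ?_ ?_
      · intro i hi
        rw [mem_Icc] at *
        omega
      · intro r hr
        rw [mem_Icc] at *
        omega
      · intro i hi
        rw [mem_Icc] at hi
        omega
      · intro r _
        simp
      · intro i hi
        rw [mem_Icc] at hi
        rw [Int.toNat_of_nonneg (by omega), deltaSeq, prefactor_eq,
          Int.toNat_of_nonneg (by omega), qPoch_zpow_mul hq0 hℓ (n := i + L) (by omega)]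
        field_simp

theorem isConjugateBaileyPair {q t : ℂ} (hq : ‖q‖ < 1) (ht : Complex.exp t = q)
    {N : ℕ} (hN : 1 ≤ N) (σ ℓ M : ℤ) (hℓ : 0 ≤ ℓ) :
    IsConjugateBaileyPair q (q ^ ℓ) (gammaSeq q t N σ ℓ M) (deltaSeq q t N σ ℓ M) := by
  have hq0 : q ≠ 0 := ht ▸ Complex.exp_ne_zero t
  intro L
  rw [gammaSeq_eq_sum hq ht hN σ ℓ M hℓ L]
  have := hasSum_sum_of_ne_finset_zero
    (f := fun r : {r : ℕ // L ≤ r} => deltaSeq q t N σ ℓ M r /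
      (qPoch q q (((r : ℕ) : ℤ) - L) * qPoch q (q ^ ℓ * q) (((r : ℕ) : ℤ) + L)))
    (s := (Icc L M.toNat).subtype (fun r => L ≤ r)) (L := SummationFilter.unconditional _) (by
      intro r hr
      rw [mem_subtype, mem_Icc] at hr
      have := r.2
      rw [deltaSeq_of_lt hq0 t N σ ℓ (by omega), zero_div])
  rwa [sum_subtype_of_mem (fun r : ℕ => deltaSeq q t N σ ℓ M r /
      (qPoch q q ((r : ℤ) - L) * qPoch q (q ^ ℓ * q) ((r : ℤ) + L)))
      (fun r hr => (mem_Icc.1 hr).1)] at this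

theorem bailey_lemma {q t : ℂ} (hq : ‖q‖ < 1) (ht : Complex.exp t = q)
    {N : ℕ} (hN : 1 ≤ N) (σ ℓ M : ℤ) (hℓ : 0 ≤ ℓ) (α β : ℕ → ℂ)
    (hαβ : IsBaileyPair q (q ^ ℓ) α β) :
    ∃ S : ℂ, HasSum (fun L => α L * gammaSeq q t N σ ℓ M L) S ∧
      HasSum (fun L => β L * deltaSeq q t N σ ℓ M L) S := by
  have hq0 : q ≠ 0 := ht ▸ Complex.exp_ne_zero t
  have h1 : HasSum (fun L => α L * gammaSeq q t N σ ℓ M L)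
      (∑ L ∈ range (M.toNat + 1), α L * gammaSeq q t N σ ℓ M L) := by
    refine hasSum_sum_of_ne_finset_zero fun L hL => ?_
    rw [mem_range] at hL
    rw [gammaSeq_of_lt hq0 t N σ ℓ (by omega), mul_zero]
  have h2 : HasSum (fun L => β L * deltaSeq q t N σ ℓ M L)
      (∑ L ∈ range (M.toNat + 1), β L * deltaSeq q t N σ ℓ M L) := by
    refine hasSum_sum_of_ne_finset_zero fun L hL => ?_
    rw [mem_range] at hL
    rw [deltaSeq_of_lt hq0 t N σ ℓ (by omega), mul_zero]
  refine ⟨_, h1, ?_⟩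
  convert h2 using 1
  simp only [gammaSeq_eq_sum hq ht hN σ ℓ M hℓ, hαβ _, mul_sum, sum_mul]
  -- Both orders of summation cover the triangle `L ≤ r ≤ M.toNat`.
  rw [sum_comm' (t' := range (M.toNat + 1)) (s' := fun r => range (r + 1))]
  · refine sum_congr rfl fun r _ => sum_congr rfl fun L _ => ?_
    ring
  · intro L r
    simp only [mem_range, mem_Icc]
    omega

end ConjBailey

theorem mainTheorem6 (q t : ℂ) (hq : ‖q‖ < 1) (ht : Complex.exp t = q)
    (N : ℕ) (hN : 1 ≤ N) (σ ℓ M : ℤ) (hσ : σ = 0 ∨ σ = 1) (hpar : Even (ℓ + σ * N)) :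
    (∀ L : ℤ,
      ∑ i ∈ Finset.Icc L M,
          ConjBailey.qPow t ((i * (i + ℓ) : ℤ) / (N : ℚ)) /
              (ConjBailey.qPoch q q (i - L) * ConjBailey.qPoch q q (i + L + ℓ) *
                ConjBailey.qPoch q q (M - i)) *
            ConjBailey.nSum q t N σ ℓ i =
        ConjBailey.qPow t ((L * (L + ℓ) : ℤ) / (N : ℚ)) /
            (ConjBailey.qPoch q q (M - L) * ConjBailey.qPoch q q (M + L + ℓ)) *
          ConjBailey.etaSum q t N σ ℓ M L) ∧
    (0 ≤ ℓ →
      ConjBailey.IsConjugateBaileyPair q (q ^ ℓ)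
        (ConjBailey.gammaSeq q t N σ ℓ M) (ConjBailey.deltaSeq q t N σ ℓ M) ∧
      ∀ α β : ℕ → ℂ, ConjBailey.IsBaileyPair q (q ^ ℓ) α β →
        ∃ S : ℂ, HasSum (fun L => α L * ConjBailey.gammaSeq q t N σ ℓ M L) S ∧
          HasSum (fun L => β L * ConjBailey.deltaSeq q t N σ ℓ M L) S) := by
  exact ⟨fun L => ConjBailey.sum_nSum_eq_etaSum hq ht hN σ ℓ M L, fun hℓ =>
    ⟨ConjBailey.isConjugateBaileyPair hq ht hN σ ℓ M hℓ,
      fun α β h => ConjBailey.bailey_lemma hq ht hN σ ℓ M hℓ α β h⟩⟩
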